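/- For an entire function $F:\mathbb C\to\mathbb C$, let $$\rho(F)=\limsup_{r\to\infty}\frac{\log\log\sup_{|z|=r}|F(z)|}{\log r}\in[0,\infty]$$ be its order (constant functions, including $0$, have order $0$), and let $m_F(z)$ be the multiplicity of $z\in\mathbb C$ as a zero of $F$, with $m_F(z)=0$ if $F(z)\neq 0$ and $m_F\equiv\infty$ if $F\equiv 0$. Let $\tau>0$ and let $F,G:\mathbb C\to\mathbb C$ be entire functions such that $|F|=|G|$ on $\mathbb R\cup(\mathbb R+i\tau)$ and $m_F=m_G$ on the strip $\mathbb R+i(-\tau,\tau]$. (a) If $\rho(F)\le 2$ and $\rho(G)\le 2$, then there is $\alpha\in\mathbb R$ with $F=e^{i\alpha}G$ on $\mathbb C$. (b) More generally, if $\rho(F)<\infty$ and $\rho(G)<\infty$, then there is $\alpha\in\mathbb R$ with $F=e^{i\alpha}G$ on $\mathbb C$. -/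

import Mathlib

open Filter

noncomputable section

/-- The maximum modulus `sup_{|z| = r} |F z|`; for continuous `F` and `r > 0` this is the supremum of
a bounded nonempty set of reals. -/
def maxModulus (F : ℂ → ℂ) (r : ℝ) : ℝ :=
  ⨆ z : Metric.sphere (0 : ℂ) r, ‖F z‖

/-- The order `limsup_{r → ∞} log (log (sup_{|z| = r} |F z|)) / log r` of an entire function, an
extended real number. For nonconstant entire `F` the maximum modulus tends to infinity, so that both
logarithms are eventually those of positive numbers; constants get order `0`, as usual. -/
def entireOrder (F : ℂ → ℂ) : EReal :=
  limsup (fun r : ℝ =>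
    ((Real.log (Real.log (maxModulus F r)) / Real.log r : ℝ) : EReal)) atTop

/-- The multiplicity of `z` as a zero of the entire function `F`: it is `0` when `F z ≠ 0`, and `⊤`
exactly when `F` vanishes identically. -/
def zeroMultiplicity (F : ℂ → ℂ) (z : ℂ) : ℕ∞ :=
  analyticOrderAt F z

/-- `F` and `G` agree up to global phase: `F = exp (i α) G` for some real `α`. -/
def AgreeUpToGlobalPhase (F G : ℂ → ℂ) : Prop :=
  ∃ α : ℝ, ∀ z : ℂ, F z = Complex.exp (Complex.I * α) * G z

end

/-! With `F*(z) = conj (F (conj z))`, equality of moduli on `ℝ` says `F F* = G G*`, and likewise on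
`ℝ + iτ`. Composing the two reflections gives `F / G` the period `2iτ`
(`mul_shift_eq_of_norm_eq_on_lines`). The strip is one period, so all zeros agree and `F = exp g *
G` with `g` entire. On both lines `g` is purely imaginary, so by reflection `g` itself has period
`2iτ`. Finite order makes `g` a polynomial (`exists_polynomial_of_eq_exp_mul`, via Poisson–Jensen,
Borel–Carathéodory and Cauchy). A periodic polynomial is constant, and this constant is imaginary.
Order at most 2 is a special case. -/

/-- An entire factor that is not identically zero may be cancelled. -/
theorem Differentiable.cancel_left {k f h : ℂ → ℂ} (hk : Differentiable ℂ k)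
    (hf : Differentiable ℂ f) (hh : Differentiable ℂ h) (hk0 : ∃ z, k z ≠ 0)
    (H : ∀ z, k z * f z = k z * h z) (z : ℂ) : f z = h z := by
  rcases AnalyticOnNhd.eq_zero_or_eq_zero_of_mul_eq_zero (U := Set.univ)
    (hk.differentiableOn.analyticOnNhd isOpen_univ)
    ((hf.sub hh).differentiableOn.analyticOnNhd isOpen_univ)
    (fun z _ => by simp [mul_sub, H z]) isPreconnected_univ with h0 | h0
  · obtain ⟨z, hz⟩ := hk0
    exact absurd (h0 z trivial) hz
  · exact sub_eq_zero.mp (h0 z trivial)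

/-- Entire functions that agree on the real line are equal. -/
theorem Differentiable.eq_of_forall_ofReal_eq {f h : ℂ → ℂ} (hf : Differentiable ℂ f)
    (hh : Differentiable ℂ h) (H : ∀ x : ℝ, f x = h x) (z : ℂ) : f z = h z := by
  have hfr : ∃ᶠ w in nhdsWithin (0 : ℂ) {0}ᶜ, f w = h w := by
    have ht : Tendsto (fun x : ℝ => (x : ℂ)) (nhdsWithin 0 {0}ᶜ) (nhdsWithin (0 : ℂ) {0}ᶜ) := by
      refine tendsto_nhdsWithin_iff.mpr ⟨?_, ?_⟩
      · exact (Complex.continuous_ofReal.tendsto' 0 0 (by simp)).mono_left nhdsWithin_le_nhds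
      · filter_upwards [self_mem_nhdsWithin] with x hx
        simpa using hx
    exact ht.frequently (Eventually.of_forall H).frequently
  exact congrFun (AnalyticOnNhd.eq_of_frequently_eq
    (hf.differentiableOn.analyticOnNhd isOpen_univ)
    (hh.differentiableOn.analyticOnNhd isOpen_univ) hfr) z

open ComplexConjugate in
theorem Differentiable.conj_conj {f : ℂ → ℂ} (hf : Differentiable ℂ f) :
    Differentiable ℂ fun z => conj (f (conj z)) :=
  fun z => by
    have := (hf (conj z)).conj_conj
    simpa [Function.comp_def] using this

open ComplexConjugate in
/-- Equality of moduli on a horizontal line, as an identity between entire functions. -/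
theorem mul_conj_eq_of_norm_eq_on_line {F G : ℂ → ℂ} (hF : Differentiable ℂ F)
    (hG : Differentiable ℂ G) (s : ℝ)
    (h : ∀ x : ℝ, ‖F ((x : ℂ) + Complex.I * (s : ℂ))‖ = ‖G ((x : ℂ) + Complex.I * (s : ℂ))‖)
    (z : ℂ) :
    F (z + Complex.I * s) * conj (F (conj z + Complex.I * s)) =
      G (z + Complex.I * s) * conj (G (conj z + Complex.I * s)) := by
  have hs : Differentiable ℂ fun z : ℂ => z + Complex.I * s := by fun_prop
  have hF' := hF.comp hs
  have hG' := hG.comp hs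
  refine Differentiable.eq_of_forall_ofReal_eq (hF'.mul hF'.conj_conj) (hG'.mul hG'.conj_conj)
    (fun x => ?_) z
  simp only [Pi.mul_apply, Function.comp_apply, Complex.conj_ofReal, Complex.mul_conj,
    Complex.normSq_eq_norm_sq, h x]

/-! ### Entire logarithm of the quotient -/

/-- Two entire functions with the same zeros differ by the exponential of an entire function. -/
theorem exists_eq_exp_mul_of_analyticOrderAt_eq {F G : ℂ → ℂ} (hF : Differentiable ℂ F)
    (hG : Differentiable ℂ G) (hG0 : ∃ z, G z ≠ 0)
    (h : ∀ z, analyticOrderAt F z = analyticOrderAt G z) :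
    ∃ g : ℂ → ℂ, Differentiable ℂ g ∧ ∀ z, F z = Complex.exp (g z) * G z := by
  have hFA : ∀ z, AnalyticAt ℂ F z := fun z => hF.analyticAt z
  have hGA : ∀ z, AnalyticAt ℂ G z := fun z => hG.analyticAt z
  have hGtop : ∀ z, analyticOrderAt G z ≠ ⊤ := by
    intro z hz
    obtain ⟨w, hw⟩ := hG0
    exact hw (congrFun ((AnalyticOnNhd.analyticOrderAt_eq_top_iff_eq_zero z
      hGA).mp hz) w)
  have hM : MeromorphicOn (F / G) Set.univ :=
    fun z _ => (hFA z).meromorphicAt.div (hGA z).meromorphicAt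
  -- The normal form fills in the removable singularities of `F / G`; having order `0` everywhere,
  -- it is entire and zero-free.
  set Q := toMeromorphicNFOn (F / G) Set.univ with hQdef
  have hQNF : ∀ z, MeromorphicNFAt Q z :=
    fun z => meromorphicNFOn_toMeromorphicNFOn (F / G) Set.univ (Set.mem_univ z)
  have hQord : ∀ z, meromorphicOrderAt Q z = 0 := by
    intro z
    rw [meromorphicOrderAt_toMeromorphicNFOn hM (Set.mem_univ z),
      meromorphicOrderAt_div (hFA z).meromorphicAt (hGA z).meromorphicAt,
      (hFA z).meromorphicOrderAt_eq, (hGA z).meromorphicOrderAt_eq, h z]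
    lift analyticOrderAt G z to ℕ using hGtop z with n
    simp only [ENat.map_natCast]
    exact LinearOrderedAddCommGroupWithTop.sub_self_eq_zero_of_ne_top (by simp)
  have hQ0 : ∀ z, Q z ≠ 0 := fun z => (hQNF z).meromorphicOrderAt_eq_zero_iff.mp (hQord z)
  have hQA : ∀ z, AnalyticAt ℂ Q z := fun z =>
    (hQNF z).meromorphicOrderAt_nonneg_iff_analyticAt.mp (hQord z).ge
  have hQd : Differentiable ℂ Q := fun z => (hQA z).differentiableAt
  have hFQ : ∀ z, F z = Q z * G z := by
    intro z
    have h1 : Q =ᶠ[nhdsWithin z {z}ᶜ] F / G :=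
      hM.toMeromorphicNFOn_eq_self_on_nhdsNE (Set.mem_univ z)
    have h2 : ∀ᶠ w in nhdsWithin z {z}ᶜ, G w ≠ 0 :=
      ((hGA z).eventually_eq_zero_or_eventually_ne_zero).resolve_left
        (fun h0 => hGtop z (analyticOrderAt_eq_top.mpr h0))
    have h3 : F =ᶠ[nhdsWithin z {z}ᶜ] fun w => Q w * G w := by
      filter_upwards [h1, h2] with w h1 h2
      rw [h1, Pi.div_apply, div_mul_cancel₀ _ h2]
    exact ((hF.continuous.continuousAt).eventuallyEq_nhds_iff_eventuallyEq_nhdsNE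
      ((hQd.continuous.mul hG.continuous).continuousAt)).mp h3 |>.eq_of_nhds
  have hL : Differentiable ℂ fun z => deriv Q z / Q z :=
    (hQd.contDiff.differentiable_deriv_two).div hQd hQ0
  obtain ⟨f, hf⟩ := hL.isExactOn_univ.with_val_at 0 (Complex.log (Q 0))
  refine ⟨f, fun z => (hf.2 z trivial).differentiableAt, fun z => ?_⟩
  have hc : ∀ w, HasDerivAt (fun w => Complex.exp (-f w) * Q w) 0 w := fun w => by
    refine ((hf.2 w trivial).neg.cexp.mul (hQA w).differentiableAt.hasDerivAt).congr_deriv ?_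
    simp only [Pi.neg_apply]
    linear_combination -Complex.exp (-f w) * div_mul_cancel₀ (deriv Q w) (hQ0 w)
  have hconst : Complex.exp (-f z) * Q z = Complex.exp (-f 0) * Q 0 :=
    is_const_of_deriv_eq_zero (fun w => (hc w).differentiableAt) (fun w => (hc w).deriv) z 0
  rw [hf.1, Complex.exp_neg, Complex.exp_neg, Complex.exp_log (hQ0 0), inv_mul_cancel₀ (hQ0 0),
    inv_mul_eq_one₀ (Complex.exp_ne_zero _)] at hconst
  rw [hFQ, hconst]

/-! ### Finite order forces a polynomial exponent -/

/-- A bound for the real part of a logarithm of `F / G` inside a disc, from bounds for `F` and `G`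
on its boundary. -/
theorem re_le_of_eq_exp_mul {F G g : ℂ → ℂ} (hG : Differentiable ℂ G)
    (hg : Differentiable ℂ g) (hG0 : G 0 ≠ 0) (hFG : ∀ z, F z = Complex.exp (g z) * G z)
    {R A : ℝ} (hR : 0 < R) (hA : 0 ≤ A) (hFA : ∀ z, ‖z‖ = R → ‖F z‖ ≤ Real.exp A)
    (hGA : ∀ z, ‖z‖ = R → ‖G z‖ ≤ Real.exp A) {w : ℂ} (hw : ‖w‖ ≤ R / 2) :
    (g w).re ≤ 3 * (A - Real.log ‖G 0‖) := by
  classical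
  have hGan : AnalyticOnNhd ℂ G Set.univ := fun z _ => hG.analyticAt z
  have hwR : w ∈ Metric.ball (0 : ℂ) R := by simp; linarith
  have habs : |R| = R := abs_of_pos hR
  have hlog : ∀ {a : ℝ}, 0 ≤ a → a ≤ Real.exp A → Real.log a ≤ A := by
    intro a ha0 ha
    rcases ha0.eq_or_lt with h | h
    · simpa [← h] using hA
    · exact (Real.log_le_iff_le_exp h).mpr ha
  have hP0 : ∀ z ∈ Metric.sphere (0 : ℂ) R, 0 ≤ poissonKernel 0 w z := by
    intro z hz
    rw [mem_sphere_zero_iff_norm] at hz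
    rw [poissonKernel_def, sub_zero, sub_zero, hz]
    have : ‖w‖ ^ 2 ≤ R ^ 2 := by gcongr; linarith
    exact div_nonneg (by linarith) (by positivity)
  -- The kernel is at most `(R + ‖w‖) / (R - ‖w‖)`, which is at most 3 for `‖w‖ ≤ R / 2`.
  have hP3 : ∀ z ∈ Metric.sphere (0 : ℂ) R, poissonKernel 0 w z ≤ 3 := by
    intro z hz
    rw [poissonKernel_eq_re_herglotzRieszKernel, Function.comp_apply, herglotzRieszKernel_def]
    refine (re_herglotzRieszKernel_le hz hwR).trans ?_
    rw [sub_zero, div_le_iff₀ (by linarith)]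
    linarith
  have hPois : Real.circleAverage (poissonKernel 0 w • fun z => (g z).re) 0 R = (g w).re :=
    InnerProductSpace.HarmonicOnNhd.circleAverage_poissonKernel_smul
      (fun z _ => (hg.analyticAt z).harmonicAt_re) hwR
  -- At zeros of `G` the convention `Real.log 0 = 0` would spoil the pointwise bound `hle`. Changing
  -- the integrand there leaves its circle average unchanged.
  set u : ℂ → ℝ := fun z => if G z = 0 then 0 else poissonKernel 0 w z * (g z).re with hu
  have hcod : u =ᶠ[codiscreteWithin (Metric.sphere (0 : ℂ) |R|)]
      poissonKernel 0 w • fun z => (g z).re := by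
    have h1 : G ⁻¹' {0}ᶜ ∈ codiscreteWithin (Metric.sphere (0 : ℂ) |R|) :=
      codiscreteWithin_mono (Set.subset_univ _)
        (AnalyticOnNhd.preimage_zero_mem_codiscrete hGan hG0)
    filter_upwards [h1] with z hz
    have hz : G z ≠ 0 := by simpa using hz
    simp [hu, hz]
  have hPint : CircleIntegrable (poissonKernel 0 w • fun z => (g z).re) 0 R := by
    refine ContinuousOn.circleIntegrable' ?_
    rw [habs]
    refine ContinuousOn.smul ?_ (Complex.continuous_re.comp hg.continuous).continuousOn
    have : poissonKernel 0 w = fun z => (‖z‖ ^ 2 - ‖w‖ ^ 2) / ‖z - w‖ ^ 2 := by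
      ext z; simp [poissonKernel_def]
    rw [this]
    refine ContinuousOn.div (by fun_prop) (by fun_prop) fun z hz => ?_
    have hzw : z ≠ w := by
      rintro rfl
      rw [mem_sphere_zero_iff_norm] at hz
      linarith
    have := sub_ne_zero.mpr hzw
    positivity
  have huint : CircleIntegrable u 0 R := hPint.congr_codiscreteWithin hcod.symm
  have hGint : CircleIntegrable (fun z => Real.log ‖G z‖) 0 R :=
    MeromorphicOn.circleIntegrable_log_norm fun z _ => (hG.analyticAt z).meromorphicAt
  have hle : ∀ z ∈ Metric.sphere (0 : ℂ) |R|, u z ≤ 3 * (A - Real.log ‖G z‖) := by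
    intro z hz
    rw [habs] at hz
    have hzR : ‖z‖ = R := mem_sphere_zero_iff_norm.mp hz
    have hGz : Real.log ‖G z‖ ≤ A := hlog (norm_nonneg _) (hGA z hzR)
    have hFz : Real.log ‖F z‖ ≤ A := hlog (norm_nonneg _) (hFA z hzR)
    by_cases h0 : G z = 0
    · simp only [hu, h0, if_true, norm_zero, Real.log_zero]
      linarith
    · simp only [hu, h0, if_false]
      have : (g z).re = Real.log ‖F z‖ - Real.log ‖G z‖ := by
        rw [hFG, norm_mul, Real.log_mul (by simp) (by simpa using h0), Complex.norm_exp,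
          Real.log_exp]
        ring
      calc poissonKernel 0 w z * (g z).re
          ≤ poissonKernel 0 w z * (A - Real.log ‖G z‖) :=
            mul_le_mul_of_nonneg_left (by linarith) (hP0 z hz)
        _ ≤ 3 * (A - Real.log ‖G z‖) :=
            mul_le_mul_of_nonneg_right (hP3 z hz) (by linarith)
  -- Jensen's formula: zeros in the disc contribute nonnegative terms.
  have hJ : Real.log ‖G 0‖ ≤ Real.circleAverage (fun z => Real.log ‖G z‖) 0 R := by
    rw [AnalyticOnNhd.circleAverage_log_norm hR.ne' (hGan.mono (Set.subset_univ _)) hG0]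
    refine le_add_of_nonneg_left (finsum_nonneg fun v => ?_)
    by_cases hv : v ∈ Metric.closedBall (0 : ℂ) |R|
    · refine mul_nonneg (Int.cast_nonneg
        (MeromorphicOn.AnalyticOnNhd.divisor_nonneg (hGan.mono (Set.subset_univ _)) v)) ?_
      rw [mem_closedBall_zero_iff, habs] at hv
      rw [zero_sub, norm_neg]
      rcases (norm_nonneg v).eq_or_lt with h | h
      · simp [← h]
      · exact Real.log_nonneg (by rw [← div_eq_mul_inv, one_le_div h]; exact hv)
    · rw [Function.locallyFinsuppWithin.apply_eq_zero_of_notMem _ hv]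
      simp
  calc (g w).re = Real.circleAverage u 0 R := by
        rw [← hPois, Real.circleAverage_congr_codiscreteWithin hcod hR.ne']
    _ ≤ Real.circleAverage (fun z => 3 * (A - Real.log ‖G z‖)) 0 R :=
        Real.circleAverage_mono huint
          (((circleIntegrable_const A 0 R).sub hGint).const_smul (a := (3 : ℝ))) hle
    _ = 3 * (A - Real.circleAverage (fun z => Real.log ‖G z‖) 0 R) := by
        have := Real.circleAverage_fun_smul (a := (3 : ℝ)) (c := 0) (R := R)
          (f := fun z => A - Real.log ‖G z‖)
        simp only [smul_eq_mul] at this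
        rw [this, Real.circleAverage_fun_sub (circleIntegrable_const A 0 R) hGint,
          Real.circleAverage_const]
    _ ≤ 3 * (A - Real.log ‖G 0‖) := by linarith

/-- If two entire functions of finite order have an entire logarithmic quotient `g`, then `g` is a
polynomial. -/
theorem exists_polynomial_of_eq_exp_mul {F G g : ℂ → ℂ} (hG : Differentiable ℂ G)
    (hg : Differentiable ℂ g) (hG0 : G 0 ≠ 0) (hFG : ∀ z, F z = Complex.exp (g z) * G z) (N : ℕ)
    (hgrow : ∀ᶠ r : ℝ in atTop, ∀ z : ℂ, ‖z‖ = r →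
      ‖F z‖ ≤ Real.exp (r ^ N) ∧ ‖G z‖ ≤ Real.exp (r ^ N)) :
    ∃ p : Polynomial ℂ, ∀ z, g z = p.eval z := by
  set L := |Real.log ‖G 0‖| with hL
  -- Borel–Carathéodory from radius `R / 2` to `R / 4` yields `2 * M + 3 * ‖g 0‖` with `M = 3 * (R ^
  -- N + L) + 1`; `R ^ N ≥ 1` absorbs the constants.
  set K := 6 * (1 + L) + 2 + 3 * ‖g 0‖ with hK
  have hL0 : 0 ≤ L := abs_nonneg _
  have hbound : ∀ᶠ R : ℝ in atTop, ∀ z : ℂ, ‖z‖ = R / 4 → ‖g z‖ ≤ K * R ^ N := by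
    filter_upwards [hgrow, eventually_ge_atTop 1] with R hR hR1 z hz
    have hRN : 1 ≤ R ^ N := one_le_pow₀ hR1
    have hb := Complex.borelCaratheodory (f := g) (R := R / 2) (M := 3 * (R ^ N + L) + 1) (z := z)
      (by positivity) hg.differentiableOn
      (fun w hw => by
        have hw : ‖w‖ < R / 2 := by simpa using hw
        have := re_le_of_eq_exp_mul (A := R ^ N) hG hg hG0 hFG (by linarith) (by linarith)
          (fun z hz => (hR z hz).1) (fun z hz => (hR z hz).2) hw.le
        have hneg := neg_abs_le (Real.log ‖G 0‖)
        simp only [Set.mem_ofPred_eq]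
        linarith) (by linarith) (by simp [hz]; linarith)
    rw [hz, show R / 2 - R / 4 = R / 4 by ring, mul_div_assoc, div_self (by linarith), mul_one,
      mul_div_assoc, show (R / 2 + R / 4) / (R / 4) = 3 by field_simp; norm_num] at hb
    refine hb.trans ?_
    have h1 := mul_le_mul_of_nonneg_left hRN hL0
    have h2 := mul_le_mul_of_nonneg_left hRN (norm_nonneg (g 0))
    rw [hK]
    linarith
  have hzero : ∀ n, N < n → iteratedDeriv n g 0 = 0 := by
    intro n hn
    -- Cauchy's estimate is of size `R ^ (N - n)`, hence `O(R⁻¹)`.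
    have hle : ∀ᶠ R : ℝ in atTop,
        ‖iteratedDeriv n g 0‖ ≤ (n.factorial * K * 4 ^ n) * R⁻¹ := by
      filter_upwards [hbound, eventually_ge_atTop 1] with R hR hR1
      have hRpos : 0 < R := by linarith
      refine (Complex.norm_iteratedDeriv_le_of_forall_mem_sphere_norm_le n (R := R / 4)
        (by linarith) hg.diffContOnCl
        (fun z hz => hR z (mem_sphere_zero_iff_norm.mp hz))).trans ?_
      have hK0 : 0 ≤ K := by positivity
      obtain ⟨m, rfl⟩ := Nat.exists_eq_add_of_lt hn
      have hm : 1 ≤ R ^ m := one_le_pow₀ hR1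
      rw [div_pow, div_div_eq_mul_div, div_le_iff₀ (by positivity)]
      calc ((N + m + 1).factorial * (K * R ^ N) * 4 ^ (N + m + 1) : ℝ)
          = ((N + m + 1).factorial * K * 4 ^ (N + m + 1)) * R ^ N * 1 := by ring
        _ ≤ ((N + m + 1).factorial * K * 4 ^ (N + m + 1)) * R ^ N * R ^ m := by gcongr
        _ = _ := by field_simp; ring
    have ht : Tendsto (fun R : ℝ => (n.factorial * K * 4 ^ n) * R⁻¹) atTop (nhds 0) := by
      simpa using tendsto_inv_atTop_zero.const_mul (n.factorial * K * 4 ^ n : ℝ)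
    exact norm_le_zero_iff.mp (ge_of_tendsto ht hle)
  refine ⟨∑ n ∈ Finset.range (N + 1),
    Polynomial.C ((n.factorial : ℂ)⁻¹ * iteratedDeriv n g 0) * Polynomial.X ^ n, fun z => ?_⟩
  rw [← Complex.taylorSeries_eq_of_entire' 0 z hg, tsum_eq_sum (s := Finset.range (N + 1)),
    Polynomial.eval_finsetSum]
  · simp
  · intro n hn
    rw [hzero n (by simpa using hn)]
    simp

/-- A function of finite order is bounded by the exponential of a power of the modulus. -/
theorem exists_norm_le_exp_pow_of_entireOrder_lt_top {F : ℂ → ℂ} (hF : Continuous F)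
    (h : entireOrder F < ⊤) :
    ∃ N : ℕ, ∃ R : ℝ, ∀ z : ℂ, R ≤ ‖z‖ → ‖F z‖ ≤ Real.exp (‖z‖ ^ N) := by
  obtain ⟨c, hc, -⟩ := EReal.lt_iff_exists_real_btwn.mp h
  obtain ⟨N, hN⟩ := exists_nat_ge c
  have hev := eventually_lt_of_limsup_lt hc
  obtain ⟨R, hR⟩ := eventually_atTop.mp (hev.and (eventually_gt_atTop 1))
  refine ⟨N, R, fun z hz => ?_⟩
  obtain ⟨hlt, hz1⟩ := hR _ hz
  set r := ‖z‖ with hr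
  have hr0 : 0 < r := by linarith
  have hle : ‖F z‖ ≤ maxModulus F r := by
    have hb : BddAbove (Set.range fun w : Metric.sphere (0 : ℂ) r => ‖F w‖) := by
      have : CompactSpace (Metric.sphere (0 : ℂ) r) :=
        isCompact_iff_compactSpace.mp (isCompact_sphere 0 r)
      exact (isCompact_range (hF.norm.comp continuous_subtype_val)).bddAbove
    exact le_ciSup hb ⟨z, by simp [hr]⟩
  refine hle.trans ?_
  -- If the inner logarithm is not positive, the iterated logarithm says nothing, but then the
  -- maximum modulus is at most 1.
  by_cases hlog : Real.log (maxModulus F r) ≤ 0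
  · rcases lt_or_ge 0 (maxModulus F r) with hpos | hneg
    · rw [← Real.log_le_iff_le_exp hpos]
      exact hlog.trans (by positivity)
    · exact hneg.trans (Real.exp_pos _).le
  · push Not at hlog
    have hpos : 0 < maxModulus F r := by
      by_contra hneg
      have : maxModulus F r = 0 := le_antisymm (not_lt.mp hneg) ((norm_nonneg _).trans hle)
      simp [this] at hlog
    have hlr : 0 < Real.log r := Real.log_pos hz1
    have h1 : Real.log (Real.log (maxModulus F r)) / Real.log r < N :=
      (EReal.coe_lt_coe_iff.mp hlt).trans_le hN
    rw [div_lt_iff₀ hlr, ← Real.log_pow] at h1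
    rw [← Real.log_le_iff_le_exp hpos]
    exact ((Real.log_lt_log_iff hlog (by positivity)).mp h1).le

/-- A polynomial function with a nonzero period is constant. -/
theorem Polynomial.eval_eq_of_periodic {p : Polynomial ℂ} {c : ℂ} (hc : c ≠ 0)
    (h : Function.Periodic (fun z => p.eval z) c) (z : ℂ) : p.eval z = p.eval 0 := by
  have hp : p = Polynomial.C (p.eval 0) := by
    refine Polynomial.eq_of_infinite_eval_eq _ _ ?_
    refine (Set.infinite_range_of_injective (f := fun n : ℕ => (n : ℂ) * c) ?_).mono ?_
    · intro m n hmn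
      simpa [hc] using hmn
    · rintro _ ⟨n, rfl⟩
      simpa using h.nat_mul_eq n
  rw [hp]
  simp

/-- The logarithmic quotient of two entire functions of finite order is a polynomial in `z - c`. -/
theorem exists_polynomial_sub_of_entireOrder_lt_top {F G g : ℂ → ℂ} (hF : Differentiable ℂ F)
    (hG : Differentiable ℂ G) (hg : Differentiable ℂ g) {c : ℂ} (hGc : G c ≠ 0)
    (hFG : ∀ z, F z = Complex.exp (g z) * G z) (hFo : entireOrder F < ⊤)
    (hGo : entireOrder G < ⊤) : ∃ p : Polynomial ℂ, ∀ z, g (z + c) = p.eval z := by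
  obtain ⟨N₁, R₁, h₁⟩ := exists_norm_le_exp_pow_of_entireOrder_lt_top hF.continuous hFo
  obtain ⟨N₂, R₂, h₂⟩ := exists_norm_le_exp_pow_of_entireOrder_lt_top hG.continuous hGo
  have hd : Differentiable ℂ fun z : ℂ => z + c := by fun_prop
  -- Recentring at `c` makes the value of `G` at the origin nonzero; the bound `‖z + c‖ ≤ r ^ 2`
  -- pays for the shift by doubling the exponent.
  refine exists_polynomial_of_eq_exp_mul (F := fun z => F (z + c)) (hG.comp hd) (hg.comp hd)
    (by simpa using hGc) (fun z => hFG (z + c)) (2 * max N₁ N₂) ?_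
  filter_upwards [eventually_ge_atTop (max R₁ R₂ + ‖c‖), eventually_ge_atTop (‖c‖ + 2)]
    with r hr1 hr2 z hz
  have hlow : r - ‖c‖ ≤ ‖z + c‖ := by
    have := norm_sub_le (z + c) c
    rw [add_sub_cancel_right, hz] at this
    linarith
  have hup : ‖z + c‖ ≤ r ^ 2 := by
    have := norm_add_le z c
    nlinarith [norm_nonneg c]
  have hpow : ∀ N ≤ max N₁ N₂, ‖z + c‖ ^ N ≤ r ^ (2 * max N₁ N₂) := by
    intro N hN
    rw [pow_mul]
    exact (pow_le_pow_right₀ (by linarith) hN).trans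
      (pow_le_pow_left₀ (norm_nonneg _) hup _)
  constructor
  · refine (h₁ _ ?_).trans (Real.exp_le_exp.mpr (hpow _ (le_max_left _ _)))
    linarith [le_max_left R₁ R₂]
  · refine (h₂ _ ?_).trans (Real.exp_le_exp.mpr (hpow _ (le_max_right _ _)))
    linarith [le_max_right R₁ R₂]

/-! ### Reflection and periodicity -/

open ComplexConjugate in
/-- If `|exp g * G| = |G|` on a horizontal line, then `g` is purely imaginary there; this is stated
as a reflection identity. -/
theorem add_conj_eq_zero_of_norm_eq_on_line {F G g : ℂ → ℂ} (hF : Differentiable ℂ F)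
    (hG : Differentiable ℂ G) (hg : Differentiable ℂ g) (hG0 : ∃ z, G z ≠ 0)
    (hFG : ∀ z, F z = Complex.exp (g z) * G z) (s : ℝ)
    (h : ∀ x : ℝ, ‖F ((x : ℂ) + Complex.I * (s : ℂ))‖ = ‖G ((x : ℂ) + Complex.I * (s : ℂ))‖)
    (z : ℂ) : g (z + Complex.I * s) + conj (g (conj z + Complex.I * s)) = 0 := by
  have hs : Differentiable ℂ fun z : ℂ => z + Complex.I * s := by fun_prop
  have hG' : Differentiable ℂ fun z => G (z + Complex.I * s) := hG.comp hs
  have hg' : Differentiable ℂ fun z => g (z + Complex.I * s) := hg.comp hs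
  have hGs : ∃ z, G (z + Complex.I * s) ≠ 0 := by
    obtain ⟨w, hw⟩ := hG0
    exact ⟨w - Complex.I * s, by simpa using hw⟩
  have hGs' : ∃ z, conj (G (conj z + Complex.I * s)) ≠ 0 := by
    obtain ⟨w, hw⟩ := hGs
    exact ⟨conj w, by simpa using hw⟩
  have hexp : ∀ z, Complex.exp (g (z + Complex.I * s)) *
      Complex.exp (conj (g (conj z + Complex.I * s))) = 1 := by
    refine Differentiable.cancel_left hG' (hg'.cexp.mul hg'.conj_conj.cexp)
      (differentiable_const 1) hGs (fun z => ?_)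
    revert z
    refine Differentiable.cancel_left hG'.conj_conj (hG'.mul (hg'.cexp.mul hg'.conj_conj.cexp))
      (hG'.mul (differentiable_const 1)) hGs' (fun z => ?_)
    have := mul_conj_eq_of_norm_eq_on_line hF hG s h z
    simp only [hFG, map_mul, ← Complex.exp_conj] at this
    linear_combination this
  refine Differentiable.eq_of_forall_ofReal_eq (hg'.add hg'.conj_conj) (differentiable_const 0)
    (fun x => ?_) z
  -- On the real line the exponent is the real number `2 * Re g`, so there is no `2πi` ambiguity.
  have hx := hexp x
  rw [Complex.conj_ofReal, ← Complex.exp_add, Complex.add_conj, ← Complex.ofReal_exp] at hx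
  have hx' := Real.exp_eq_one_iff _ |>.mp (Complex.ofReal_eq_one.mp hx)
  simp only [Pi.add_apply, Complex.conj_ofReal, Complex.add_conj, hx', Complex.ofReal_zero]

open ComplexConjugate in
/-- If `|F| = |G|` on `ℝ` and on `ℝ + iτ`, then `F / G` has the period `2iτ`. -/
theorem mul_shift_eq_of_norm_eq_on_lines {F G : ℂ → ℂ} (hF : Differentiable ℂ F)
    (hG : Differentiable ℂ G) (hF0 : ∃ z, F z ≠ 0) (τ : ℝ)
    (hline₀ : ∀ x : ℝ, ‖F (x : ℂ)‖ = ‖G (x : ℂ)‖)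
    (hlineτ : ∀ x : ℝ, ‖F ((x : ℂ) + Complex.I * (τ : ℂ))‖ = ‖G ((x : ℂ) + Complex.I * (τ : ℂ))‖)
    (z : ℂ) : F z * G (z + 2 * (Complex.I * τ)) = G z * F (z + 2 * (Complex.I * τ)) := by
  have hs : Differentiable ℂ fun z : ℂ => z + 2 * (Complex.I * τ) := by fun_prop
  have hF' : Differentiable ℂ fun z => F (z + 2 * (Complex.I * τ)) := hF.comp hs
  have hG' : Differentiable ℂ fun z => G (z + 2 * (Complex.I * τ)) := hG.comp hs
  have h1 : ∀ z, F z * conj (F (conj z)) = G z * conj (G (conj z)) := fun z => by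
    simpa using mul_conj_eq_of_norm_eq_on_line hF hG 0 (by simpa using hline₀) z
  have h2 : ∀ z, F z * conj (F (conj z + 2 * (Complex.I * τ))) =
      G z * conj (G (conj z + 2 * (Complex.I * τ))) := fun z => by
    have := mul_conj_eq_of_norm_eq_on_line hF hG τ hlineτ (z - Complex.I * τ)
    have e : conj z + Complex.I * τ + Complex.I * τ = conj z + 2 * (Complex.I * τ) := by ring
    simpa [e] using this
  have h3 : ∀ z, conj (F (conj z)) * conj (G (conj z + 2 * (Complex.I * τ))) =
      conj (G (conj z)) * conj (F (conj z + 2 * (Complex.I * τ))) := by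
    -- Both `h1` and `h2` contain `F z` and `G z`; cross-multiplying eliminates `G z` and leaves the
    -- factor `F z` to cancel.
    refine Differentiable.cancel_left hF (hF.conj_conj.mul hG'.conj_conj)
      (hG.conj_conj.mul hF'.conj_conj) hF0 (fun z => ?_)
    linear_combination conj (G (conj z + 2 * (Complex.I * τ))) * h1 z - conj (G (conj z)) * h2 z
  simpa using congrArg conj (h3 (conj z))

theorem analyticOrderAt_comp_add_const (f : ℂ → ℂ) (c z : ℂ) :
    analyticOrderAt (fun w => f (w + c)) z = analyticOrderAt f (z + c) :=
  analyticOrderAt_comp_of_deriv_ne_zero (f := f) (g := fun w => w + c) (by fun_prop) (by simp)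

/-- If `F / G` is periodic, then equality of the multiplicities of zeros is periodic too. -/
theorem analyticOrderAt_shift_eq_iff {F G : ℂ → ℂ} (hF : Differentiable ℂ F)
    (hG : Differentiable ℂ G) (hF0 : ∃ z, F z ≠ 0) (hG0 : ∃ z, G z ≠ 0) {c : ℂ}
    (h : ∀ z, F z * G (z + c) = G z * F (z + c)) (z : ℂ) :
    analyticOrderAt F (z + c) = analyticOrderAt G (z + c) ↔
      analyticOrderAt F z = analyticOrderAt G z := by
  have htop : ∀ {f : ℂ → ℂ}, Differentiable ℂ f → (∃ z, f z ≠ 0) →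
      ∀ z, analyticOrderAt f z ≠ ⊤ := by
    rintro f hf ⟨w, hw⟩ z hz
    exact hw (congrFun ((AnalyticOnNhd.analyticOrderAt_eq_top_iff_eq_zero z hf.analyticAt).mp hz) w)
  have hs : Differentiable ℂ fun z : ℂ => z + c := by fun_prop
  have hF' : Differentiable ℂ fun z => F (z + c) := hF.comp hs
  have hG' : Differentiable ℂ fun z => G (z + c) := hG.comp hs
  have key := congrArg (fun f => analyticOrderAt f z)
    (funext h : (F * fun z => G (z + c)) = G * fun z => F (z + c))
  rw [analyticOrderAt_mul (hF.analyticAt z) (hG'.analyticAt z),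
    analyticOrderAt_mul (hG.analyticAt z) (hF'.analyticAt z), analyticOrderAt_comp_add_const,
    analyticOrderAt_comp_add_const] at key
  have a1 := htop hF hF0 z
  have a2 := htop hG hG0 z
  have a3 := htop hF hF0 (z + c)
  have a4 := htop hG hG0 (z + c)
  generalize analyticOrderAt F z = n1 at *
  generalize analyticOrderAt G z = n2 at *
  generalize analyticOrderAt F (z + c) = n3 at *
  generalize analyticOrderAt G (z + c) = n4 at *
  lift n1 to ℕ using a1
  lift n2 to ℕ using a2
  lift n3 to ℕ using a3
  lift n4 to ℕ using a4
  norm_cast at *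
  omega

/-! ### Conclusion -/

theorem agreeUpToGlobalPhase_of_entireOrder_lt_top {τ : ℝ} (hτ : 0 < τ) {F G : ℂ → ℂ}
    (hF : Differentiable ℂ F) (hG : Differentiable ℂ G)
    (hline₀ : ∀ x : ℝ, ‖F (x : ℂ)‖ = ‖G (x : ℂ)‖)
    (hlineτ : ∀ x : ℝ, ‖F ((x : ℂ) + Complex.I * (τ : ℂ))‖ = ‖G ((x : ℂ) + Complex.I * (τ : ℂ))‖)
    (hzeros : ∀ z : ℂ, -τ < z.im → z.im ≤ τ → zeroMultiplicity F z = zeroMultiplicity G z)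
    (hFo : entireOrder F < ⊤) (hGo : entireOrder G < ⊤) : AgreeUpToGlobalPhase F G := by
  have hz0 : F = 0 ↔ G = 0 := by
    rw [← AnalyticOnNhd.analyticOrderAt_eq_top_iff_eq_zero 0 hF.analyticAt,
      ← AnalyticOnNhd.analyticOrderAt_eq_top_iff_eq_zero 0 hG.analyticAt]
    have := hzeros 0 (by simpa using hτ) (by simpa using hτ.le)
    simp only [zeroMultiplicity] at this
    rw [this]
  by_cases hG0 : G = 0
  · exact ⟨0, fun z => by simp [hG0, hz0.mpr hG0]⟩
  have hF0 : ∃ z, F z ≠ 0 := Function.ne_iff.mp (hz0.not.mpr hG0)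
  replace hG0 : ∃ z, G z ≠ 0 := Function.ne_iff.mp hG0
  set c : ℂ := 2 * (Complex.I * τ) with hc
  have hc0 : c ≠ 0 := by simp [hc, hτ.ne']
  have hshift := mul_shift_eq_of_norm_eq_on_lines hF hG hF0 τ hline₀ hlineτ
  have horder : ∀ z, analyticOrderAt F z = analyticOrderAt G z := by
    intro z
    have hper : Function.Periodic (fun z => analyticOrderAt F z = analyticOrderAt G z) c :=
      fun z => propext (analyticOrderAt_shift_eq_iff hF hG hF0 hG0 hshift z)
    -- The half-open strip has height exactly `2τ`, so every point has a translate in it.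
    obtain ⟨k, hk, -⟩ := existsUnique_add_zsmul_mem_Ioc (show (0 : ℝ) < 2 * τ by linarith)
      z.im (-τ)
    have him : (z + k * c).im = z.im + k • (2 * τ) := by simp [hc]
    rw [Set.mem_Ioc, ← him] at hk
    exact (hper.int_mul k z).mp (hzeros (z + k * c) hk.1 (by linarith [hk.2]))
  obtain ⟨g, hg, hFG⟩ := exists_eq_exp_mul_of_analyticOrderAt_eq hF hG hG0 horder
  have hr₀ := add_conj_eq_zero_of_norm_eq_on_line hF hG hg hG0 hFG 0 (by simpa using hline₀)
  have hrτ := add_conj_eq_zero_of_norm_eq_on_line hF hG hg hG0 hFG τ hlineτ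
  -- Reflecting in `ℝ` and then in `ℝ + iτ` is translation by `2iτ`; the two sign changes of `g`
  -- cancel.
  have hper : Function.Periodic g c := by
    intro z
    have h1 := hr₀ (starRingEnd ℂ z)
    have h2 := hrτ (starRingEnd ℂ z - Complex.I * τ)
    have e : z + Complex.I * τ + Complex.I * τ = z + c := by rw [hc]; ring
    simp only [Complex.ofReal_zero, mul_zero, add_zero, sub_add_cancel, map_sub, map_mul,
      Complex.conj_conj, Complex.conj_I, Complex.conj_ofReal, neg_mul, sub_neg_eq_add, e] at h1 h2
    exact (starRingEnd ℂ).injective (by linear_combination h2 - h1)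
  obtain ⟨a, ha⟩ := hG0
  obtain ⟨p, hp⟩ := exists_polynomial_sub_of_entireOrder_lt_top hF hG hg ha hFG hFo hGo
  have hpper : Function.Periodic (fun z => p.eval z) c := fun z => by
    simp only [← hp]
    rw [add_right_comm, hper]
  have hconst : ∀ z, g z = g 0 := fun z => by
    have h1 := hp (z - a)
    have h2 := hp (0 - a)
    rw [sub_add_cancel, Polynomial.eval_eq_of_periodic hc0 hpper] at h1 h2
    rw [h1, h2]
  have hre : (g 0).re = 0 := by
    have := hr₀ 0
    simpa [Complex.add_conj] using this
  refine ⟨(g 0).im, fun z => ?_⟩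
  have him : g 0 = Complex.I * (g 0).im := by
    apply Complex.ext <;> simp [hre]
  rw [hFG, hconst, ← him]

theorem mainTheorem3 (τ : ℝ) (hτ : 0 < τ) (F G : ℂ → ℂ)
    (hF : Differentiable ℂ F) (hG : Differentiable ℂ G)
    (hline₀ : ∀ x : ℝ, ‖F (x : ℂ)‖ = ‖G (x : ℂ)‖)
    (hlineτ : ∀ x : ℝ, ‖F ((x : ℂ) + Complex.I * (τ : ℂ))‖ = ‖G ((x : ℂ) + Complex.I * (τ : ℂ))‖)
    (hzeros : ∀ z : ℂ, -τ < z.im → z.im ≤ τ → zeroMultiplicity F z = zeroMultiplicity G z) :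
    (entireOrder F ≤ 2 → entireOrder G ≤ 2 → AgreeUpToGlobalPhase F G) ∧
    (entireOrder F < ⊤ → entireOrder G < ⊤ → AgreeUpToGlobalPhase F G) := by
  have h := agreeUpToGlobalPhase_of_entireOrder_lt_top hτ hF hG hline₀ hlineτ hzeros
  have h2 : (2 : EReal) < ⊤ := EReal.coe_lt_top 2
  exact ⟨fun hFo hGo => h (hFo.trans_lt h2) (hGo.trans_lt h2), h⟩
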